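/- Consider finite simple undirected graphs $G$ (not necessarily connected) with $n$ vertices, whose vertices carry distinct identifiers in $\{1,\dots,n^c\}$, where $c\ge 1$ is a fixed integer. A local certification with verification radius $1$ and size $s(n)$ of a graph property $P$ is a verification algorithm, that is, an accept/reject function of the radius-$1$ view of a vertex $v$ (the identifier of $v$, the identifiers and certificates of $v$ and of its neighbours, and the edges at $v$; certificates are finite bit strings), such that, for every $n$, every $n$-vertex graph $G$ and every assignment of identifiers: if $G$ satisfies $P$, then some assignment of certificates of at most $s(n)$ bits makes all vertices accept; if $G$ does not satisfy $P$, then for every assignment of certificates at least one vertex rejects. Let $T$ be a finite tree, and let $P_T$ be the property that $G$ does not contain $T$ as a (not necessarily induced) subgraph. (i) For every $c\ge 1$, the property $P_T$ has a local certification with verification radius $1$ and size $O(\log n)$, where the implied constant depends only on $T$ and $c$. (ii) This is tight for every tree with large enough diameter, namely at least $4$: if $T$ has diameter at least $4$, then there are $\varepsilon>0$ and $N$, depending only on $T$, such that for every $c\ge 1$, every local certification of $P_T$ with verification radius $1$ has size $s(n)\ge \varepsilon\log n$ for all $n\ge N$. -/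

import Mathlib

namespace LocalCert

/-- What a vertex sees. Vertices are named by their (unique) identifiers:
`center` is the identifier of the observing vertex, `nodes` the set of pairs
(identifier, certificate) in sight, `edges` the set of visible edges, each one as both
ordered pairs of the identifiers of its ends. -/
structure View where
  center : ℕ
  nodes : Set (ℕ × List Bool)
  edges : Set (ℕ × ℕ)

/-- The view at distance `d` of the vertex `v`: the vertices at distance at most `d` from `v`, with
their identifiers and certificates, and the edges between them, except the edges between two
vertices at distance exactly `d`. (`edist` is the distance with value `⊤` across components.) -/
def view {V : Type} (G : SimpleGraph V) (ident : V → ℕ) (cert : V → List Bool) (d : ℕ) (v : V) :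
    View where
  center := ident v
  nodes := {p | ∃ u, G.edist v u ≤ d ∧ p = (ident u, cert u)}
  edges := {p | ∃ a b, G.Adj a b ∧ G.edist v a ≤ d ∧ G.edist v b ≤ d ∧
    ¬ (G.edist v a = d ∧ G.edist v b = d) ∧ p = (ident a, ident b)}

/-- Identifiers on `O(log n)` bits: distinct numbers in `{1, …, n ^ c}`, where `n` is the number of
vertices. -/
def IsIdentifier {V : Type} [Fintype V] (c : ℕ) (ident : V → ℕ) : Prop :=
  Function.Injective ident ∧ ∀ v, 1 ≤ ident v ∧ ident v ≤ Fintype.card V ^ c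

/-- `HasLocalCertification c d P s`: for networks with identifiers in `{1, …, n ^ c}`, there is a
local certification of the graph property `P` with verification radius `d` and with certificates of
at most `s n` bits on `n`-vertex graphs. The verification algorithm `accept` is a function of the
view only; in particular it is not told `n`. -/
def HasLocalCertification (c d : ℕ) (P : ∀ V : Type, SimpleGraph V → Prop) (s : ℕ → ℕ) : Prop :=
  ∃ accept : View → Prop,
    ∀ (V : Type) [Fintype V] (G : SimpleGraph V) (ident : V → ℕ), IsIdentifier c ident →
      (P V G → ∃ cert : V → List Bool, (∀ v, (cert v).length ≤ s (Fintype.card V)) ∧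
        ∀ v, accept (view G ident cert d v)) ∧
      (¬ P V G → ∀ cert : V → List Bool, ∃ v, ¬ accept (view G ident cert d v))

end LocalCert

/-!
Upper bound. Root `T` at `r` and colour the vertices of `G` by those of `T`. A set `b` of vertices
is closed if it contains every vertex that has, for each child of its colour, a neighbour in `b` of
that colour. The least closed set consists of roots of properly coloured branches of `T`, so it has
no vertex of colour `r` if `G` is `T`-free; conversely, every closed set contains the properly
coloured copies of `T`. One bit per vertex therefore certifies that `G` has no properly coloured
copy of `T`. A family of `O(log n)` colourings of the identifiers, which exists by the probabilistic
method, colours every copy of `T` properly at least once.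

Lower bound. A tree of diameter at least four has a leaf `w` whose neighbour `p` is at distance at
least three from some vertex `u`. Replacing the edge `pw` by `pu` gives a `T`-free graph `R`, as one
vertex is lost, while crossing the edges `pu` of two copies of `R` produces a copy of `T`, with the
other `u` as leaf. Let a copy of `R` occupy a block of identifiers of one kind around `u` and
a block of another kind elsewhere. With certificates of `ℓ` bits there are `2 ^ O(ℓ)` possible
labellings, so among `2 ^ O(ℓ)` blocks the pigeonhole principle gives two blocks of each kind all
four combinations of which are certified identically. Each vertex of the crossed graph on these
blocks then has the same view as in one of the four copies, so this graph is accepted as well.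
-/

namespace LocalCert

open SimpleGraph

section RootedTree

variable {W : Type*} {T : SimpleGraph W} {r a b c : W}

/-- In the tree `T` rooted at `r`, the vertex `b` is a child of `a`: the root enters only through
the distances from it. -/
def IsChild (T : SimpleGraph W) (r a b : W) : Prop :=
  T.Adj a b ∧ T.dist r b = T.dist r a + 1

lemma exists_isChild_of_ne (hr : T.Reachable r b) (hb : b ≠ r) : ∃ a, IsChild T r a b := by
  obtain ⟨p, hp⟩ := hr.exists_walk_length_eq_dist
  have hnil : ¬ p.Nil := Walk.not_nil_of_ne hb.symm
  have hadj := p.adj_penultimate hnil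
  have hlength := p.length_dropLast_add_one hnil
  have hle := dist_le p.dropLast
  have hdiff := hadj.diff_dist_adj (u := r)
  exact ⟨p.penultimate, hadj, by omega⟩

lemma IsChild.ne_root (h : IsChild T r a b) : b ≠ r := by
  rintro rfl
  simp [IsChild] at h

lemma IsChild.exists_isPath_penultimate_eq (h : IsChild T r a b) :
    ∃ p : T.Walk r b, p.IsPath ∧ p.penultimate = a := by
  have hreach : T.Reachable r b := .of_dist_ne_zero (by rw [h.2]; exact Nat.succ_ne_zero _)
  obtain ⟨q, hq⟩ := (hreach.trans h.1.symm.reachable).exists_walk_length_eq_dist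
  refine ⟨q.concat h.1, Walk.isPath_of_length_eq_dist _ ?_, Walk.penultimate_concat ..⟩
  rw [Walk.length_concat, hq, h.2]

lemma IsChild.parent_unique (hT : T.IsAcyclic) (ha : IsChild T r a c) (hb : IsChild T r b c) :
    a = b := by
  obtain ⟨p, hp, rfl⟩ := ha.exists_isPath_penultimate_eq
  obtain ⟨q, hq, rfl⟩ := hb.exists_isPath_penultimate_eq
  exact congrArg (fun p : T.Path r c ↦ p.1.penultimate)
    ((hT.subsingleton_path r c).elim ⟨p, hp⟩ ⟨q, hq⟩)

lemma isChild_or_isChild_of_adj (hT : T.IsTree) (r : W) (h : T.Adj a b) :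
    IsChild T r a b ∨ IsChild T r b a :=
  (hT.dist_eq_dist_add_one_of_adj r h).symm.imp (⟨h, ·⟩) (⟨h.symm, ·⟩)

lemma exists_section_of_isChild (hT : T.IsTree) {S : W → Type*} {R : ∀ a b, S a → S b → Prop}
    (hroot : Nonempty (S r)) (hstep : ∀ a b, IsChild T r a b → ∀ s : S a, ∃ t : S b, R a b s t) :
    ∃ f : ∀ w, S w, ∀ a b, IsChild T r a b → R a b (f a) (f b) := by
  classical
  obtain ⟨s₀⟩ := hroot
  choose parent hparent using fun b (hb : b ≠ r) ↦ exists_isChild_of_ne (hT.connected r b) hb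
  choose next hnext using hstep
  have hlt : ∀ b hb, T.dist r (parent b hb) < T.dist r b := fun b hb ↦ by
    rw [(hparent b hb).2]
    exact Nat.lt_succ_self _
  let F (b : W) (f : ∀ a, T.dist r a < T.dist r b → S a) : S b :=
    if hb : b = r then hb ▸ s₀
    else next (parent b hb) b (hparent b hb) (f (parent b hb) (hlt b hb))
  refine ⟨(measure (T.dist r)).wf.fix F, fun a b hab ↦ ?_⟩
  have hb := hab.ne_root
  obtain rfl : a = parent b hb := hab.parent_unique hT.isAcyclic (hparent b hb)
  rw [(measure (T.dist r)).wf.fix_eq F b]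
  simp only [F, dif_neg hb]
  exact hnext ..

end RootedTree

section Branches

variable {W V : Type*} {T : SimpleGraph W} {G : SimpleGraph V} {r : W} {col : V → W}

/-- For a colouring `col` of the vertices of `G` by the vertices of `T`, rooted at `r`: the vertices
that have, for every child of their colour, a neighbour in `b` of that colour. The fixed points of
this operator are the candidates for the set of roots of properly coloured copies of branches
of `T`. -/
def branchStep (T : SimpleGraph W) (r : W) (G : SimpleGraph V) (col : V → W) :
    Set V →o Set V where
  toFun b := {v | ∀ w, IsChild T r (col v) w → ∃ x ∈ b, G.Adj v x ∧ col x = w}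
  monotone' _ _ hb _ hv w hw := (hv w hw).imp fun _ ↦ And.imp_left (hb ·)

lemma mem_branchStep {b : Set V} {v : V} : v ∈ branchStep T r G col b ↔
    ∀ w, IsChild T r (col v) w → ∃ x ∈ b, G.Adj v x ∧ col x = w :=
  Iff.rfl

lemma isContained_of_subset_branchStep (hT : T.IsTree) {b : Set V}
    (hb : b ⊆ branchStep T r G col b) {v : V} (hv : v ∈ b) (hr : col v = r) :
    T.IsContained G := by
  obtain ⟨f, hf⟩ := exists_section_of_isChild hT (S := fun w ↦ {x // x ∈ b ∧ col x = w})
    (R := fun _ _ s t ↦ G.Adj s t) ⟨v, hv, hr⟩ fun w w' hw s ↦ by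
      obtain ⟨x, hx, hadj, hcol⟩ := hb s.2.1 w' (s.2.2.symm ▸ hw)
      exact ⟨⟨x, hx, hcol⟩, hadj⟩
  have hinj : Function.Injective fun w ↦ (f w : V) :=
    Function.LeftInverse.injective (g := col) fun w ↦ (f w).2.2
  exact ⟨⟨⟨fun w ↦ f w, fun {a b} hab ↦ (isChild_or_isChild_of_adj hT r hab).elim (hf a b)
    fun h ↦ (hf b a h).symm⟩, hinj⟩⟩

lemma exists_branchStep_subset_of_free (hT : T.IsTree) (hG : T.Free G) (r : W) (col : V → W) :
    ∃ b, branchStep T r G col b ⊆ b ∧ ∀ v ∈ b, col v ≠ r := by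
  have hfix : branchStep T r G col (branchStep T r G col).lfp = (branchStep T r G col).lfp :=
    (branchStep T r G col).map_lfp
  exact ⟨_, hfix.subset, fun v hv hr ↦ hG (isContained_of_subset_branchStep hT hfix.superset hv hr)⟩

lemma map_mem_branchStep [Finite W] (φ : T →g G) (hφ : Function.LeftInverse col φ) {b : Set V}
    (hb : ∀ w, φ w ∈ branchStep T r G col b → φ w ∈ b) (w : W) :
    φ w ∈ branchStep T r G col b := by
  induction w using (Finite.wellFounded_of_trans_of_irrefl
    (InvImage (· > ·) (T.dist r))).induction with
  | _ w ih =>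
    refine mem_branchStep.2 fun x hx ↦ ?_
    rw [hφ] at hx
    have hlt : T.dist r x > T.dist r w := hx.2 ▸ Nat.lt_succ_self _
    exact ⟨φ x, hb x (ih x hlt), φ.map_adj hx.1, hφ x⟩

end Branches

section PerfectHash

open Finset

/-- A family of maps `ℕ → W` is a perfect hash family for `{0, …, N - 1}` if every injection of `W`
into `{0, …, N - 1}` is inverted (and not only composed to an injection) by some member. -/
def IsPerfectHashFamily {ι W : Type*} (N : ℕ) (h : ι → ℕ → W) : Prop :=
  ∀ φ : W → ℕ, Function.Injective φ → (∀ w, φ w < N) → ∃ i, Function.LeftInverse (h i) φ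

/-- The probabilistic method: `t` independent random elements of `Ω` fail to contain a good one for
some `i` with probability at most `card ι * p ^ t`. -/
lemma exists_forall_exists_of_card_mul_pow_lt_one {Ω ι : Type*} [Fintype Ω] [Nonempty Ω]
    [Fintype ι] {good : ι → Ω → Prop} [∀ i, DecidablePred (good i)] {p : ℝ}
    (hp : ∀ i, (#{ω | ¬ good i ω} : ℝ) ≤ p * Fintype.card Ω) {t : ℕ}
    (ht : Fintype.card ι * p ^ t < 1) : ∃ g : Fin t → Ω, ∀ i, ∃ j, good i (g j) := by
  classical
  by_contra! hbad
  have hcover : (univ : Finset (Fin t → Ω)) ⊆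
      univ.biUnion fun i ↦ Fintype.piFinset fun _ ↦ {ω | ¬ good i ω} := fun g _ ↦ by
    simpa using hbad g
  have hcard : (Fintype.card Ω : ℝ) ^ t ≤ Fintype.card ι * p ^ t * Fintype.card Ω ^ t := by
    calc (Fintype.card Ω : ℝ) ^ t = (#(univ : Finset (Fin t → Ω)) : ℝ) := by simp
      _ ≤ ∑ i, (#{ω | ¬ good i ω} : ℝ) ^ t := by
        have := (card_le_card hcover).trans card_biUnion_le
        simp only [Fintype.card_piFinset_const] at this
        exact_mod_cast this
      _ ≤ ∑ _i : ι, (p * Fintype.card Ω) ^ t := by gcongr with i; exact hp i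
      _ = Fintype.card ι * p ^ t * Fintype.card Ω ^ t := by
        rw [sum_const, card_univ, nsmul_eq_mul, mul_pow, mul_assoc]
  have hpos : (0 : ℝ) < Fintype.card Ω ^ t := by positivity
  nlinarith

variable {α W : Type*} [Fintype α] [Fintype W] [DecidableEq α] [DecidableEq W]

lemma card_fun_le_mul_card_leftInverse (φ : W ↪ α) :
    Fintype.card (α → W) ≤
      Fintype.card (W → W) * #{g : α → W | Function.LeftInverse g φ} := by
  rw [← Fintype.card_subtype, ← Fintype.card_prod]
  refine Fintype.card_le_of_injective (fun g ↦ (g ∘ φ,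
    ⟨Function.extend φ id g, fun w ↦ φ.injective.extend_apply id g w⟩)) fun g g' h ↦ ?_
  simp only [Prod.mk.injEq, Subtype.mk.injEq] at h
  funext a
  by_cases ha : ∃ w, φ w = a
  · obtain ⟨w, rfl⟩ := ha
    exact congrFun h.1 w
  · simpa only [Function.extend_apply' _ _ _ ha] using congrFun h.2 a

lemma card_not_leftInverse_le [Nonempty W] (φ : W ↪ α) :
    (#{g : α → W | ¬ Function.LeftInverse g φ} : ℝ) ≤
      (1 - 1 / Fintype.card (W → W)) * Fintype.card (α → W) := by
  have hpos : (0 : ℝ) < Fintype.card (W → W) := by exact_mod_cast Fintype.card_pos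
  have hsplit : (#{g : α → W | Function.LeftInverse g φ} : ℝ) +
      #{g : α → W | ¬ Function.LeftInverse g φ} = Fintype.card (α → W) := by
    exact_mod_cast card_filter_add_card_filter_not (s := univ) (Function.LeftInverse · φ)
  have hgood : (Fintype.card (α → W) : ℝ) / Fintype.card (W → W) ≤
      #{g : α → W | Function.LeftInverse g φ} := by
    rw [div_le_iff₀' hpos]
    exact_mod_cast card_fun_le_mul_card_leftInverse φ
  rw [sub_mul, one_mul, one_div_mul_eq_div]
  linarith

lemma exists_isPerfectHashFamily_two_pow (W : Type*) [Finite W] [Nonempty W] :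
    ∃ K : ℕ, K ≠ 0 ∧ ∀ m, m ≠ 0 → ∃ h : Fin (K * m) → ℕ → W, IsPerfectHashFamily (2 ^ m) h := by
  classical
  have := Fintype.ofFinite W
  set k := Fintype.card W
  set p : ℝ := 1 - 1 / Fintype.card (W → W)
  have hcard : (1 : ℝ) ≤ Fintype.card (W → W) := by exact_mod_cast Fintype.card_pos
  have hp₀ : 0 ≤ p := sub_nonneg.2 ((div_le_one (by positivity)).2 hcard)
  have hp₁ : p < 1 := sub_lt_self _ (by positivity)
  obtain ⟨K, hK⟩ := exists_pow_lt_of_lt_one (show (0 : ℝ) < (2 ^ k)⁻¹ by positivity) hp₁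
  refine ⟨K, ?_, fun m hm ↦ ?_⟩
  · rintro rfl
    exact (inv_le_one_of_one_le₀ (one_le_pow₀ one_le_two)).not_gt (pow_zero p ▸ hK)
  have hfail : Fintype.card (W ↪ Fin (2 ^ m)) * p ^ (K * m) < 1 := by
    have hembed : (Fintype.card (W ↪ Fin (2 ^ m)) : ℝ) ≤ (2 ^ m) ^ k := by
      rw [Fintype.card_embedding_eq, Fintype.card_fin]
      exact_mod_cast Nat.descFactorial_le_pow _ _
    calc Fintype.card (W ↪ Fin (2 ^ m)) * p ^ (K * m) ≤ (2 ^ m) ^ k * p ^ (K * m) := by gcongr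
      _ = (2 ^ k * p ^ K) ^ m := by ring
      _ < 1 := pow_lt_one₀ (by positivity) ((lt_inv_mul_iff₀ (by positivity)).1 (by simpa)) hm
  obtain ⟨g, hg⟩ := exists_forall_exists_of_card_mul_pow_lt_one
    (fun φ : W ↪ Fin (2 ^ m) ↦ card_not_leftInverse_le φ) hfail
  refine ⟨fun i x ↦ g i (Fin.ofNat (2 ^ m) x), fun φ hφ hlt ↦ ?_⟩
  have hmod : ∀ w, Fin.ofNat (2 ^ m) (φ w) = ⟨φ w, hlt w⟩ := fun w ↦
    Fin.ext (Nat.mod_eq_of_lt (hlt w))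
  obtain ⟨i, hi⟩ := hg ⟨fun w ↦ ⟨φ w, hlt w⟩, fun a b hab ↦ hφ (Fin.mk.inj_iff.1 hab)⟩
  exact ⟨i, fun w ↦ (congrArg (g i) (hmod w)).trans (hi w)⟩

end PerfectHash

section View

variable {V : Type} {G G' : SimpleGraph V} {ident : V → ℕ} {cert cert' : V → List Bool} {v : V}

lemma view_one : view G ident cert 1 v =
    { center := ident v
      nodes := (fun u ↦ (ident u, cert u)) '' insert v (G.neighborSet v)
      edges := (fun u ↦ (ident v, ident u)) '' G.neighborSet v ∪
        (fun u ↦ (ident u, ident v)) '' G.neighborSet v } := by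
  simp only [view, View.mk.injEq, Nat.cast_one, edist_le_one_iff_adj_or_eq,
    edist_eq_one_iff_adj]
  refine ⟨trivial, ?_, ?_⟩
  · ext p
    simp only [Set.mem_ofPred_eq, Set.mem_image, Set.mem_insert_iff, mem_neighborSet]
    exact exists_congr fun u ↦ and_congr (or_comm.trans (or_congr_left eq_comm)) eq_comm
  · ext p
    simp only [Set.mem_ofPred_eq, Set.mem_union, Set.mem_image, mem_neighborSet]
    constructor
    · rintro ⟨a, b, hab, ha | rfl, hb | rfl, hne, rfl⟩
      · exact absurd ⟨ha, hb⟩ hne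
      · exact .inr ⟨a, ha, rfl⟩
      · exact .inl ⟨b, hb, rfl⟩
      · exact absurd hab G.irrefl
    · rintro (⟨u, hu, rfl⟩ | ⟨u, hu, rfl⟩)
      · exact ⟨v, u, hu, .inr rfl, .inl hu, fun h ↦ G.irrefl h.1, rfl⟩
      · exact ⟨u, v, hu.symm, .inl hu, .inr rfl, fun h ↦ G.irrefl h.2, rfl⟩

lemma view_one_congr (hadj : G.neighborSet v = G'.neighborSet v)
    (hcert : Set.EqOn cert cert' (insert v (G.neighborSet v))) :
    view G ident cert 1 v = view G' ident cert' 1 v := by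
  rw [view_one, view_one, ← hadj]
  congr 1
  exact Set.image_congr fun u hu ↦ by rw [hcert hu]

/-- Since identifiers are distinct, a view of radius one determines the labels (identifier and
certificate) of the vertex and of its neighbours, so any property of these labels is the acceptance
condition of a verification algorithm. -/
lemma exists_accept_iff (A : ℕ × List Bool → Set (ℕ × List Bool) → Prop) :
    ∃ accept : View → Prop, ∀ (V : Type) (G : SimpleGraph V) (ident : V → ℕ)
      (cert : V → List Bool), Function.Injective ident → ∀ v,
        (accept (view G ident cert 1 v) ↔
          A (ident v, cert v) ((fun u ↦ (ident u, cert u)) '' G.neighborSet v)) := by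
  refine ⟨fun X ↦ ∃ l, (X.center, l) ∈ X.nodes ∧
    A (X.center, l) {q ∈ X.nodes | (X.center, q.1) ∈ X.edges}, fun V G ident cert hid v ↦ ?_⟩
  have hown : ∀ l, (ident v, l) ∈ (view G ident cert 1 v).nodes ↔ l = cert v := fun l ↦ by
    rw [view_one]
    constructor
    · rintro ⟨u, -, hu⟩
      obtain ⟨huv, rfl⟩ := Prod.mk.inj hu
      rw [hid huv]
    · rintro rfl
      exact ⟨v, Set.mem_insert .., rfl⟩
  have hnbrs : {q ∈ (view G ident cert 1 v).nodes |
      (ident v, q.1) ∈ (view G ident cert 1 v).edges} =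
      (fun u ↦ (ident u, cert u)) '' G.neighborSet v := by
    rw [view_one]
    ext q
    constructor
    · rintro ⟨⟨u, -, rfl⟩, ⟨x, hx, h⟩ | ⟨x, hx, h⟩⟩
      · obtain rfl := hid (Prod.mk.inj h).2
        exact ⟨x, hx, rfl⟩
      · obtain rfl := hid (Prod.mk.inj h).1
        exact absurd hx G.irrefl
    · rintro ⟨u, hu, rfl⟩
      exact ⟨⟨u, Set.mem_insert_of_mem _ hu, rfl⟩, .inl ⟨u, hu, rfl⟩⟩
  change (∃ l, (ident v, l) ∈ (view G ident cert 1 v).nodes ∧ A (ident v, l) _) ↔ _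
  simp only [hown, exists_eq_left]
  exact iff_of_eq (congrArg _ hnbrs)

end View

section Verification

variable {W : Type*} {T : SimpleGraph W} {r : W} {L : ℕ → ℕ} {h : ∀ m, Fin (L m) → ℕ → W}

/-- The verification algorithm for `T`-freeness, with `T` rooted at `r`, as a condition on the label
(identifier and certificate) of a vertex and the labels of its neighbours. Certificates of length
`L m` serve identifiers below `2 ^ (m + 1)`; their bit `i` marks the members of a set that is closed
under `branchStep` for the colouring `h m i` of the identifiers and contains no vertex of
colour `r`. -/
def BranchCheck (T : SimpleGraph W) (r : W) (h : ∀ m, Fin (L m) → ℕ → W) (own : ℕ × List Bool)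
    (nbrs : Set (ℕ × List Bool)) : Prop :=
  ∃ m, own.1 < 2 ^ (m + 1) ∧ (∀ q ∈ insert own nbrs, q.2.length = L m) ∧ ∀ i : Fin (L m),
    (∀ w, IsChild T r (h m i own.1) w →
      ∃ q ∈ nbrs, q.2[(i : ℕ)]? = some true ∧ h m i q.1 = w) →
    own.2[(i : ℕ)]? = some true ∧ h m i own.1 ≠ r

variable {V : Type*} {G : SimpleGraph V} {ident : V → ℕ} {cert : V → List Bool}

lemma branchCheck_labels {v : V} :
    BranchCheck T r h (ident v, cert v) ((fun u ↦ (ident u, cert u)) '' G.neighborSet v) ↔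
      ∃ m, ident v < 2 ^ (m + 1) ∧
        (∀ u ∈ insert v (G.neighborSet v), (cert u).length = L m) ∧ ∀ i : Fin (L m),
          v ∈ branchStep T r G (fun u ↦ h m i (ident u)) {u | (cert u)[(i : ℕ)]? = some true} →
          (cert v)[(i : ℕ)]? = some true ∧ h m i (ident v) ≠ r := by
  simp only [BranchCheck, mem_branchStep, Set.mem_ofPred_eq, Set.forall_mem_insert,
    Set.forall_mem_image, Set.exists_mem_image, mem_neighborSet, and_left_comm]

lemma exists_cert_mem_iff {L : ℕ} (b : Fin L → Set V) :
    ∃ cert : V → List Bool, (∀ v, (cert v).length = L) ∧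
      ∀ (i : Fin L) v, (cert v)[(i : ℕ)]? = some true ↔ v ∈ b i := by
  classical
  exact ⟨fun v ↦ List.ofFn fun i ↦ decide (v ∈ b i), fun v ↦ List.length_ofFn, fun i v ↦ by simp⟩

lemma exists_cert_branchCheck (hT : T.IsTree) (hG : T.Free G) (r : W)
    (h : ∀ m, Fin (L m) → ℕ → W) {m : ℕ} (hm : ∀ v, ident v < 2 ^ (m + 1)) :
    ∃ cert : V → List Bool, (∀ v, (cert v).length = L m) ∧ ∀ v,
      BranchCheck T r h (ident v, cert v) ((fun u ↦ (ident u, cert u)) '' G.neighborSet v) := by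
  choose b hclosed hroot using fun i : Fin (L m) ↦
    exists_branchStep_subset_of_free hT hG r fun u ↦ h m i (ident u)
  obtain ⟨cert, hlength, hcert⟩ := exists_cert_mem_iff b
  refine ⟨cert, hlength, fun v ↦ branchCheck_labels.2 ⟨m, hm v, fun u _ ↦ hlength u, fun i hv ↦ ?_⟩⟩
  simp only [hcert, Set.ofPred_mem_eq] at hv ⊢
  exact ⟨hclosed i hv, hroot i v (hclosed i hv)⟩

lemma eq_of_forall_adj_eq (hT : T.Preconnected) {α : Type*} {f : W → α}
    (hf : ∀ a b, T.Adj a b → f a = f b) (a b : W) : f a = f b :=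
  Relation.ReflTransGen.rec rfl (fun _ hbc hab ↦ hab.trans (hf _ _ hbc))
    ((reachable_iff_reflTransGen a b).1 (hT a b))

lemma free_of_branchCheck [Finite W] (hT : T.Preconnected) (hL : Function.Injective L)
    (hh : ∀ m, IsPerfectHashFamily (2 ^ (m + 1)) (h m)) (hid : Function.Injective ident)
    (hcheck : ∀ v,
      BranchCheck T r h (ident v, cert v) ((fun u ↦ (ident u, cert u)) '' G.neighborSet v)) :
    T.Free G := by
  rintro ⟨φ⟩
  choose m hlt hlength hclosed using fun v ↦ branchCheck_labels.1 (hcheck v)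
  have hm : ∀ w, m (φ w) = m (φ r) := fun w ↦ by
    refine eq_of_forall_adj_eq hT (f := fun w ↦ m (φ w)) (fun a b hab ↦ hL ?_) w r
    rw [← hlength (φ a) (φ b) (Set.mem_insert_of_mem _ (φ.toHom.map_adj hab)),
      hlength (φ b) (φ b) (Set.mem_insert ..)]
  obtain ⟨i, hi⟩ := hh (m (φ r)) (fun w ↦ ident (φ w)) (hid.comp φ.injective)
    fun w ↦ hm w ▸ hlt (φ w)
  have hclosed' : ∀ w, φ w ∈ branchStep T r G (fun u ↦ h (m (φ r)) i (ident u))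
      {u | (cert u)[(i : ℕ)]? = some true} →
      (cert (φ w))[(i : ℕ)]? = some true ∧ h (m (φ r)) i (ident (φ w)) ≠ r := fun w ↦ by
    have := hclosed (φ w)
    rw [hm w] at this
    exact this i
  exact (hclosed' r (map_mem_branchStep φ.toHom hi (fun w hw ↦ (hclosed' w hw).1) r)).2 (hi r)

theorem hasLocalCertification_free [Finite W] (hT : T.IsTree) (hL : Function.Injective L)
    (hh : ∀ m, IsPerfectHashFamily (2 ^ (m + 1)) (h m)) (c : ℕ) :
    HasLocalCertification c 1 (fun _ G ↦ T.Free G) fun n ↦ L (Nat.log 2 (n ^ c)) := by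
  obtain ⟨r⟩ := hT.connected.nonempty
  obtain ⟨accept, haccept⟩ := exists_accept_iff (BranchCheck T r h)
  refine ⟨accept, fun V _ G ident hid ↦ ?_⟩
  simp only [haccept V G ident _ hid.1]
  constructor
  · intro hG
    obtain ⟨cert, hlength, hcheck⟩ := exists_cert_branchCheck hT hG r h fun v ↦
      (hid.2 v).2.trans_lt (Nat.lt_pow_succ_log_self one_lt_two _)
    exact ⟨cert, fun v ↦ (hlength v).le, hcheck⟩
  · intro hG cert
    by_contra! hcheck
    exact hG (free_of_branchCheck hT.connected.preconnected hL hh hid.1 hcheck)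

lemma natLog_two_pow_add_one_le (c : ℕ) {n : ℕ} (hn : 2 ≤ n) :
    (Nat.log 2 (n ^ c) + 1 : ℝ) ≤ (c + 1) / Real.log 2 * Real.log n := by
  have hlog : Real.log 2 ≤ Real.log n := Real.log_le_log two_pos (by exact_mod_cast hn)
  have hlogb : (Nat.log 2 (n ^ c) : ℝ) ≤ Real.logb 2 (n ^ c) := by
    exact_mod_cast Real.natLog_le_logb (n ^ c) 2
  rw [Real.logb_pow, Real.logb] at hlogb
  have hone : 1 ≤ Real.log n / Real.log 2 := (one_le_div (Real.log_pos one_lt_two)).2 hlog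
  calc (Nat.log 2 (n ^ c) + 1 : ℝ) ≤ c * (Real.log n / Real.log 2) + Real.log n / Real.log 2 := by
        gcongr
    _ = (c + 1) / Real.log 2 * Real.log n := by ring

theorem exists_hasLocalCertification_free_le_mul_log [Finite W] (hT : T.IsTree) (c : ℕ) :
    ∃ (s : ℕ → ℕ) (C : ℝ), HasLocalCertification c 1 (fun _ G ↦ T.Free G) s ∧
      ∀ n : ℕ, 2 ≤ n → (s n : ℝ) ≤ C * Real.log n := by
  have := hT.connected.nonempty
  obtain ⟨K, hK, hfamily⟩ := exists_isPerfectHashFamily_two_pow W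
  choose h hh using fun m ↦ hfamily (m + 1) m.succ_ne_zero
  have hinj : Function.Injective fun m ↦ K * (m + 1) :=
    (mul_right_injective₀ hK).comp (add_left_injective 1)
  refine ⟨_, K * ((c + 1) / Real.log 2), hasLocalCertification_free hT hinj hh c, fun n hn ↦ ?_⟩
  push_cast
  rw [mul_assoc]
  exact mul_le_mul_of_nonneg_left (natLog_two_pow_add_one_le c hn) K.cast_nonneg

end Verification

section FarLeaf

variable {W : Type*} {T : SimpleGraph W} {u p w : W}

/-- `w` is a leaf with neighbour `p`, and `p` is at distance at least three from `u`; the latter is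
expressed by disjointness of the closed neighbourhoods. -/
structure IsFarLeaf (T : SimpleGraph W) (u p w : W) : Prop where
  adj : T.Adj p w
  eq_of_adj : ∀ y, T.Adj y w → y = p
  disjoint : Disjoint (insert u (T.neighborSet u)) (insert p (T.neighborSet p))

lemma IsFarLeaf.ne (h : IsFarLeaf T u p w) : u ≠ w := by
  rintro rfl
  exact Set.disjoint_left.1 h.disjoint (Set.mem_insert ..) (Set.mem_insert_of_mem _ h.adj)

lemma exists_isFarLeaf [Finite W] (hT : T.IsTree) (hd : 4 ≤ T.diam) :
    ∃ u p w, IsFarLeaf T u p w := by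
  have := hT.connected.nonempty
  obtain ⟨u, w, huw⟩ := T.exists_dist_eq_diam
  have hle (y : W) : T.dist u y ≤ T.diam :=
    dist_le_diam (connected_iff_ediam_ne_top.1 hT.connected)
  have hwu : w ≠ u := by
    rintro rfl
    rw [dist_self] at huw
    omega
  obtain ⟨p, hp⟩ := exists_isChild_of_ne (hT.connected u w) hwu
  refine ⟨u, p, w, hp.1, fun y hy ↦ ?_, Set.disjoint_left.2 fun z hzu hzp ↦ ?_⟩
  · rcases isChild_or_isChild_of_adj hT u hy with h | h
    · exact h.parent_unique hT.isAcyclic hp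
    · have := hle y
      have := h.2
      omega
  · have hclosed {a : W} (ha : z ∈ insert a (T.neighborSet a)) : T.dist a z ≤ 1 := by
      rcases ha with rfl | ha
      · simp
      · exact (dist_eq_one_iff_adj.2 ha).le
    have htriangle : T.dist u p ≤ T.dist u z + T.dist z p := hT.connected.dist_triangle
    rw [T.dist_comm (u := z)] at htriangle
    have := hclosed hzu
    have := hclosed hzp
    have := hp.2
    omega

lemma card_le_card_support_of_isContained {V : Type*} {G : SimpleGraph V} [Finite G.support]
    (hT : T.support = Set.univ) (h : T.IsContained G) : Nat.card W ≤ Nat.card G.support := by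
  obtain ⟨φ⟩ := h
  have hmem (x : W) : φ x ∈ G.support := by
    obtain ⟨y, hxy⟩ := T.mem_support.1 (hT ▸ Set.mem_univ x)
    exact G.mem_support.2 ⟨φ y, φ.toHom.map_adj hxy⟩
  exact Nat.card_le_card_of_injective (fun x ↦ ⟨φ x, hmem x⟩)
    fun x y hxy ↦ φ.injective (Subtype.ext_iff.1 hxy)

lemma IsFarLeaf.free_map [Finite W] (hT : T.support = Set.univ) (h : IsFarLeaf T u p w)
    {V : Type*} (g : W ↪ V) : T.Free ((T.deleteIncidenceSet w ⊔ edge u p).map g) := by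
  set R := T.deleteIncidenceSet w ⊔ edge u p
  have hw : w ∉ R.support := by
    simp [R, mem_support, deleteIncidenceSet_adj, edge_adj, h.ne.symm, h.adj.ne']
  have hsupport : (R.map g).support = g '' R.support := by rw [support_map]
  have : Finite (R.map g).support := by rw [hsupport]; infer_instance
  intro hcontained
  refine (card_le_card_support_of_isContained hT hcontained).not_gt ?_
  rw [hsupport, Nat.card_image_of_injective g.injective]
  exact Finite.card_subtype_lt hw

end FarLeaf

section TwoLift

variable {W : Type*} {H K : SimpleGraph W}

/-- Two sheets over `H ⊔ K`, in which the edges of `H` stay in their sheet and those of `K` change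
the sheet; a double cover if `H` and `K` have no common edge. -/
def twoLift (H K : SimpleGraph W) : SimpleGraph (Bool × W) where
  Adj a b := H.Adj a.2 b.2 ∧ a.1 = b.1 ∨ K.Adj a.2 b.2 ∧ a.1 ≠ b.1
  symm := ⟨fun _ _ ↦ Or.imp (And.imp Adj.symm Eq.symm) (And.imp Adj.symm Ne.symm)⟩
  loopless := ⟨fun _ ↦ Or.rec (fun h ↦ H.irrefl h.1) (fun h ↦ K.irrefl h.1)⟩

lemma snd_image_neighborSet_twoLift (a : Bool × W) :
    Prod.snd '' (twoLift H K).neighborSet a = (H ⊔ K).neighborSet a.2 := by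
  ext y
  constructor
  · rintro ⟨b, ⟨hb, -⟩ | ⟨hb, -⟩, rfl⟩
    exacts [.inl hb, .inr hb]
  · rintro (hy | hy)
    exacts [⟨(a.1, y), .inl ⟨hy, rfl⟩, rfl⟩, ⟨(!a.1, y), .inr ⟨hy, by simp⟩, rfl⟩]

lemma IsFarLeaf.isContained_twoLift {T : SimpleGraph W} {u p w : W} (h : IsFarLeaf T u p w) :
    T.IsContained (twoLift (T.deleteIncidenceSet w) (edge u p)) := by
  classical
  let f (x : W) : Bool × W := if x = w then (true, u) else (false, x)
  have hup : u ≠ p := by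
    rintro rfl
    exact Set.disjoint_left.1 h.disjoint (Set.mem_insert ..) (Set.mem_insert ..)
  have hleaf : (twoLift (T.deleteIncidenceSet w) (edge u p)).Adj (f p) (f w) := by
    simp [f, twoLift, h.adj.ne, edge_adj, hup.symm]
  have hhom {x y : W} (hxy : T.Adj x y) :
      (twoLift (T.deleteIncidenceSet w) (edge u p)).Adj (f x) (f y) := by
    by_cases hx : x = w
    · subst hx
      rw [h.eq_of_adj y hxy.symm]
      exact hleaf.symm
    by_cases hy : y = w
    · subst hy
      rw [h.eq_of_adj x hxy]
      exact hleaf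
    simp only [f, if_neg hx, if_neg hy]
    exact .inl ⟨deleteIncidenceSet_adj.2 ⟨hxy, hx, hy⟩, rfl⟩
  refine ⟨⟨f, hhom⟩, fun x y hxy ↦ ?_⟩
  by_cases hx : x = w <;> by_cases hy : y = w <;> simp_all [f]

lemma view_map_twoLift {V : Type} {f : W ↪ V} {g : Bool × W ↪ V} {a : Bool × W}
    {ident : V → ℕ} {cert cert' : V → List Bool} {κ : W → List Bool}
    (hfg : Set.EqOn (f ∘ Prod.snd) g (insert a ((twoLift H K).neighborSet a)))
    (hcert : ∀ x, cert (f x) = κ x) (hcert' : ∀ b, cert' (g b) = κ b.2) :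
    view ((H ⊔ K).map f) ident cert 1 (g a) = view ((twoLift H K).map g) ident cert' 1 (g a) := by
  have hadj : ((H ⊔ K).map f).neighborSet (g a) = ((twoLift H K).map g).neighborSet (g a) := by
    rw [neighborSet_map, ← hfg (Set.mem_insert ..), Function.comp_apply, neighborSet_map,
      ← snd_image_neighborSet_twoLift, ← Set.image_comp]
    exact (hfg.mono (Set.subset_insert ..)).image_eq
  refine view_one_congr hadj ?_
  rw [hadj, neighborSet_map, ← Set.image_insert_eq]
  rintro _ ⟨b, hb, rfl⟩
  rw [hcert', ← hfg hb, Function.comp_apply, hcert]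

end TwoLift

section Gluing

variable {W A B V : Type*} (N : Set W) (e : (A ⊕ B) × W ↪ V)

open Classical in
/-- The embedding of `W` that places the vertices in `N` in the block `a` of the first kind and the
other ones in the block `b` of the second kind. -/
noncomputable def placement (a : A) (b : B) : W ↪ V where
  toFun x := e (if x ∈ N then .inl a else .inr b, x)
  inj' _ _ h := congrArg Prod.snd (e.injective h)

variable {N e}

lemma placement_of_mem {a : A} {b : B} {x : W} (hx : x ∈ N) :
    placement N e a b x = e (.inl a, x) :=
  congrArg (fun k ↦ e (k, x)) (if_pos hx)

lemma placement_of_notMem {a : A} {b : B} {x : W} (hx : x ∉ N) :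
    placement N e a b x = e (.inr b, x) :=
  congrArg (fun k ↦ e (k, x)) (if_neg hx)

variable (N e)

/-- The embedding of two disjoint copies of `W` that places the copy `s` in the blocks `i s` and
`j s`. -/
noncomputable def twoPlacement (i : Bool ↪ A) (j : Bool ↪ B) : Bool × W ↪ V where
  toFun a := placement N e (i a.1) (j a.1) a.2
  inj' := by
    rintro ⟨s, x⟩ ⟨t, y⟩ h
    obtain rfl : x = y := congrArg Prod.snd (e.injective h)
    by_cases hx : x ∈ N
    · simpa [placement_of_mem hx] using h
    · simpa [placement_of_notMem hx] using h

variable {N e} {T : SimpleGraph W} {u p w : W}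

lemma mem_or_eq_of_mem_insert_neighborSet_twoLift {s r : Bool} {x y : W}
    (hy : (r, y) ∈ insert (s, x)
      ((twoLift (T.deleteIncidenceSet w) (edge u p)).neighborSet (s, x))) :
    y ∈ insert x (T.neighborSet x) ∧ r = s ∨ (x = u ∧ y = p ∨ x = p ∧ y = u) ∧ r = !s := by
  rcases hy with hy | ⟨hy, hr⟩ | ⟨hy, hr⟩
  · obtain ⟨rfl, rfl⟩ := Prod.mk.inj hy
    exact .inl ⟨Set.mem_insert .., rfl⟩
  · exact .inl ⟨.inr (deleteIncidenceSet_adj.1 hy).1, hr.symm⟩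
  · exact .inr ⟨(edge_adj ..).1 hy |>.1, Bool.eq_not_of_ne hr.symm⟩

/-- Around every vertex, the two copies look like a single placement: the indices of its two blocks
have to differ only around `u` and `p`, the ends of the edge that changes the sheet. -/
lemma IsFarLeaf.exists_eqOn_placement (h : IsFarLeaf T u p w) (i : Bool ↪ A) (j : Bool ↪ B)
    (a : Bool × W) :
    ∃ s t, Set.EqOn (placement (insert u (T.neighborSet u)) e (i s) (j t) ∘ Prod.snd)
      (twoPlacement (insert u (T.neighborSet u)) e i j)
      (insert a ((twoLift (T.deleteIncidenceSet w) (edge u p)).neighborSet a)) := by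
  set N := insert u (T.neighborSet u)
  have hfar {y : W} (hy : y ∈ insert p (T.neighborSet p)) : y ∉ N :=
    Set.disjoint_right.1 h.disjoint hy
  have hu : u ∈ N := Set.mem_insert ..
  have hp : p ∉ N := hfar (Set.mem_insert ..)
  have hup : u ≠ p := fun hup ↦ hp (hup ▸ hu)
  have hmem {s t x} (hx : x ∈ N) :
      placement N e (i s) (j t) x = twoPlacement N e i j (s, x) :=
    (placement_of_mem hx).trans (placement_of_mem hx).symm
  have hnotMem {s t x} (hx : x ∉ N) :
      placement N e (i s) (j t) x = twoPlacement N e i j (t, x) :=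
    (placement_of_notMem hx).trans (placement_of_notMem hx).symm
  obtain ⟨s, x⟩ := a
  rcases eq_or_ne x u with rfl | hxu
  · refine ⟨s, !s, fun ⟨r, y⟩ hy ↦ ?_⟩
    rcases mem_or_eq_of_mem_insert_neighborSet_twoLift hy with
      ⟨hyN, rfl⟩ | ⟨⟨-, rfl⟩ | ⟨hx, -⟩, rfl⟩
    exacts [hmem hyN, hnotMem hp, absurd hx hup]
  rcases eq_or_ne x p with rfl | hxp
  · refine ⟨!s, s, fun ⟨r, y⟩ hy ↦ ?_⟩
    rcases mem_or_eq_of_mem_insert_neighborSet_twoLift hy with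
      ⟨hyp, rfl⟩ | ⟨⟨hx, -⟩ | ⟨-, rfl⟩, rfl⟩
    exacts [hnotMem (hfar hyp), absurd hx hxu, hmem hu]
  · refine ⟨s, s, fun ⟨r, y⟩ hy ↦ ?_⟩
    rcases mem_or_eq_of_mem_insert_neighborSet_twoLift hy with
      ⟨-, rfl⟩ | ⟨⟨hx, -⟩ | ⟨hx, -⟩, -⟩
    exacts [rfl, absurd hx hxu, absurd hx hxp]

/-- The certificates outside the two copies come from the graph without edges. -/
lemma IsFarLeaf.exists_cert_accept (h : IsFarLeaf T u p w) {V : Type} {e : (A ⊕ B) × W ↪ V}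
    {ident : V → ℕ} {accept : View → Prop} (i : Bool ↪ A) (j : Bool ↪ B)
    {cert : A → B → V → List Bool} {κ : W → List Bool} {cert₀ : V → List Bool}
    (haccept : ∀ a b v, accept (view ((T.deleteIncidenceSet w ⊔ edge u p).map
      (placement (insert u (T.neighborSet u)) e a b)) ident (cert a b) 1 v))
    (hκ : ∀ s t x,
      cert (i s) (j t) (placement (insert u (T.neighborSet u)) e (i s) (j t) x) = κ x)
    (haccept₀ : ∀ v, accept (view ⊥ ident cert₀ 1 v)) :
    ∃ cert' : V → List Bool, ∀ v,
      accept (view ((twoLift (T.deleteIncidenceSet w) (edge u p)).map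
        (twoPlacement (insert u (T.neighborSet u)) e i j)) ident cert' 1 v) := by
  set g := twoPlacement (insert u (T.neighborSet u)) e i j
  refine ⟨Function.extend g (κ ∘ Prod.snd) cert₀, fun v ↦ ?_⟩
  by_cases hv : ∃ a, g a = v
  · obtain ⟨a, rfl⟩ := hv
    obtain ⟨s, t, hst⟩ := h.exists_eqOn_placement (e := e) i j a
    exact view_map_twoLift hst (hκ s t) (fun b ↦ g.injective.extend_apply ..) ▸
      haccept (i s) (j t) (g a)
  · convert haccept₀ v using 1
    have hnbrs : ((twoLift (T.deleteIncidenceSet w) (edge u p)).map g).neighborSet v = ∅ :=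
      Set.eq_empty_of_forall_notMem fun x hx ↦ by
        obtain ⟨a, -, -, ha, -⟩ := (map_adj ..).1 hx
        exact hv ⟨a, ha⟩
    refine view_one_congr (by rw [hnbrs, neighborSet_bot]) ?_
    rw [hnbrs]
    rintro _ (rfl | h)
    exacts [Function.extend_apply' _ _ _ hv, h.elim]

end Gluing

section Counting

variable {A B : Type*}

lemma exists_monochromatic_rectangle {C : Type*} [Finite C] (hB : Nat.card C < Nat.card B)
    (hA : Nat.card B ^ 2 * Nat.card C < Nat.card A) (f : A → B → C) :
    ∃ (i : Bool ↪ A) (j : Bool ↪ B) (κ : C), ∀ s t, f (i s) (j t) = κ := by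
  have : Finite B := Nat.finite_of_card_ne_zero (Nat.ne_zero_of_lt hB)
  choose b b' heq hne using fun a ↦ Function.not_injective_iff.1 fun hf : (f a).Injective ↦
    hB.not_ge (Nat.card_le_card_of_injective _ hf)
  obtain ⟨x, y, hxy, hne'⟩ : ∃ x y, ((b x, b' x), f x (b x)) = ((b y, b' y), f y (b y)) ∧ x ≠ y :=
    Function.not_injective_iff.1 fun hf ↦ hA.not_ge <|
      (Nat.card_le_card_of_injective _ hf).trans_eq (by rw [Nat.card_prod, Nat.card_prod, sq])
  obtain ⟨⟨hb, hb'⟩, hf⟩ : (b x = b y ∧ b' x = b' y) ∧ f x (b x) = f y (b y) := by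
    simpa only [Prod.mk.injEq] using hxy
  refine ⟨⟨fun s ↦ cond s x y, Bool.injective_iff.2 hne'.symm⟩,
    ⟨fun t ↦ cond t (b x) (b' x), Bool.injective_iff.2 (hne x).symm⟩, f x (b x), ?_⟩
  rintro (_ | _) (_ | _)
  · exact (congrArg (f y) hb').trans ((heq y).symm.trans hf.symm)
  · exact (congrArg (f y) hb).trans hf.symm
  · exact (heq x).symm
  · rfl

lemma natCard_list_length_le_le (α : Type*) [Finite α] (ℓ : ℕ) :
    Nat.card {l : List α // l.length ≤ ℓ} ≤ (Nat.card α + 1) ^ ℓ := by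
  have hinj : Function.Injective fun (l : {l : List α // l.length ≤ ℓ}) (t : Fin ℓ) ↦
      l.1[(t : ℕ)]? := fun l l' h ↦ by
    refine Subtype.ext (List.ext_getElem? fun k ↦ ?_)
    rcases lt_or_ge k ℓ with hk | hk
    · exact congrFun h ⟨k, hk⟩
    · rw [List.getElem?_eq_none (l.2.trans hk), List.getElem?_eq_none (l'.2.trans hk)]
  simpa [Nat.card_fun, Finite.card_option] using Nat.card_le_card_of_injective _ hinj

variable {W : Type*} [Finite W] {T : SimpleGraph W} {u p w : W}

theorem IsFarLeaf.not_hasLocalCertification (hT : T.support = Set.univ) (h : IsFarLeaf T u p w)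
    {V : Type} [Fintype V] (e : (A ⊕ B) × W ↪ V) {c : ℕ} {ident : V → ℕ}
    (hid : IsIdentifier c ident) {s : ℕ → ℕ}
    (hB : Nat.card (W → {l : List Bool // l.length ≤ s (Fintype.card V)}) < Nat.card B)
    (hA : Nat.card B ^ 2 * Nat.card (W → {l : List Bool // l.length ≤ s (Fintype.card V)}) <
      Nat.card A) :
    ¬ HasLocalCertification c 1 (fun _ G ↦ T.Free G) s := by
  rintro ⟨accept, haccept⟩
  have : Finite {l : List Bool // l.length ≤ s (Fintype.card V)} := List.finite_length_le ..
  choose cert hlength hcert using fun a b ↦ (haccept V _ ident hid).1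
    (h.free_map hT (placement (insert u (T.neighborSet u)) e a b))
  obtain ⟨cert₀, -, hcert₀⟩ := (haccept V ⊥ ident hid).1
    (free_bot fun hbot ↦ by simpa [hbot] using h.adj)
  obtain ⟨i, j, κ, hκ⟩ := exists_monochromatic_rectangle hB hA fun a b x ↦
    ⟨cert a b (placement (insert u (T.neighborSet u)) e a b x), hlength a b _⟩
  obtain ⟨cert', hcert'⟩ := h.exists_cert_accept i j (κ := fun x ↦ (κ x).1) hcert
    (fun s t x ↦ congrArg Subtype.val (congrFun (hκ s t) x)) hcert₀
  obtain ⟨v, hv⟩ := (haccept V _ ident hid).2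
    (not_not.2 (h.isContained_twoLift.trans ⟨(Embedding.map _ _).toCopy⟩)) cert'
  exact hv (hcert' v)

/-- The numbers of blocks are those that `exists_monochromatic_rectangle` needs for `q` colours. -/
lemma nonempty_blocks_embedding (W : Type*) [Finite W] {q n : ℕ} (hq : 1 ≤ q)
    (hn : 7 * Nat.card W * q ^ 3 ≤ n) :
    Nonempty ((Fin ((q + 1) ^ 2 * q + 1) ⊕ Fin (q + 1)) × W ↪ Fin n) := by
  have := Fintype.ofFinite W
  refine Function.Embedding.nonempty_of_card_le ?_
  rw [Nat.card_eq_fintype_card] at hn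
  simp only [Fintype.card_prod, Fintype.card_sum, Fintype.card_fin]
  have hq₁ : q ≤ q ^ 3 := Nat.le_self_pow three_ne_zero q
  have hq₂ : q ^ 2 ≤ q ^ 3 := Nat.pow_le_pow_right hq (by norm_num)
  have hblocks : (q + 1) ^ 2 * q + 1 + (q + 1) ≤ 7 * q ^ 3 := by linarith
  calc _ ≤ 7 * q ^ 3 * Fintype.card W := Nat.mul_le_mul_right _ hblocks
    _ ≤ n := by linarith

lemma isIdentifier_val_add_one {c : ℕ} (hc : 1 ≤ c) (n : ℕ) :
    IsIdentifier c fun v : Fin n ↦ (v : ℕ) + 1 := by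
  refine ⟨fun _ _ h ↦ Fin.ext (Nat.succ_injective h), fun v ↦ ⟨Nat.succ_pos _, ?_⟩⟩
  rw [Fintype.card_fin]
  exact v.2.trans_le (Nat.le_self_pow (Nat.one_le_iff_ne_zero.1 hc) n)

theorem IsFarLeaf.lt_mul_pow_of_hasLocalCertification (hT : T.support = Set.univ)
    (h : IsFarLeaf T u p w) {c : ℕ} (hc : 1 ≤ c) {s : ℕ → ℕ}
    (hs : HasLocalCertification c 1 (fun _ G ↦ T.Free G) s) (n : ℕ) :
    n < 7 * Nat.card W * (27 ^ Nat.card W) ^ s n := by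
  set q := Nat.card (W → {l : List Bool // l.length ≤ s n}) with hq
  have hq_le : q ≤ (3 ^ s n) ^ Nat.card W := by
    rw [hq, Nat.card_fun]
    gcongr
    simpa using natCard_list_length_le_le Bool (s n)
  have hq_pos : 1 ≤ q := by
    have : Finite {l : List Bool // l.length ≤ s n} := List.finite_length_le ..
    have : Nonempty {l : List Bool // l.length ≤ s n} := ⟨[], Nat.zero_le _⟩
    exact Nat.card_pos
  have hpow : ((3 ^ s n) ^ Nat.card W) ^ 3 = (27 ^ Nat.card W) ^ s n := by
    rw [show 27 = 3 ^ 3 from rfl]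
    simp only [← pow_mul]
    congr 1
    ring
  by_contra! hn
  rw [← hpow] at hn
  obtain ⟨e⟩ := nonempty_blocks_embedding W hq_pos
    ((Nat.mul_le_mul_left _ (Nat.pow_le_pow_left hq_le 3)).trans hn)
  refine h.not_hasLocalCertification hT e (isIdentifier_val_add_one hc n) (s := s) ?_ ?_ hs
  · simp only [Fintype.card_fin, Nat.card_fin, ← hq]
    exact Nat.lt_succ_self q
  · simp only [Fintype.card_fin, Nat.card_fin, ← hq]
    exact Nat.lt_succ_self _

lemma exists_mul_log_le_of_le_mul_pow {a b : ℝ} (ha : 0 < a) (hb : 1 < b) :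
    ∃ (ε : ℝ) (N : ℕ), 0 < ε ∧ ∀ n, N ≤ n → ∀ ℓ : ℕ, n ≤ a * b ^ ℓ → ε * Real.log n ≤ ℓ := by
  obtain ⟨N, hN⟩ := exists_nat_ge (max (a ^ 2) 1)
  have hlogb : 0 < Real.log b := Real.log_pos hb
  refine ⟨1 / (2 * Real.log b), N, by positivity, fun n hn ℓ hℓ ↦ ?_⟩
  have hNn : max (a ^ 2) 1 ≤ (n : ℝ) := hN.trans (by exact_mod_cast hn)
  have hn0 : (0 : ℝ) < n := one_pos.trans_le ((le_max_right ..).trans hNn)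
  have hloga : 2 * Real.log a ≤ Real.log n := by
    simpa using Real.log_le_log (by positivity) ((le_max_left ..).trans hNn)
  have hlogn : Real.log n ≤ Real.log a + ℓ * Real.log b := by
    simpa [Real.log_mul ha.ne' (pow_pos (one_pos.trans hb) ℓ).ne'] using Real.log_le_log hn0 hℓ
  rw [one_div, inv_mul_le_iff₀ (by positivity)]
  linarith

theorem IsFarLeaf.exists_mul_log_le_of_hasLocalCertification (hT : T.support = Set.univ)
    (h : IsFarLeaf T u p w) :
    ∃ (ε : ℝ) (N : ℕ), 0 < ε ∧ ∀ c : ℕ, 1 ≤ c → ∀ s : ℕ → ℕ,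
      HasLocalCertification c 1 (fun _ G ↦ T.Free G) s →
        ∀ n : ℕ, N ≤ n → ε * Real.log n ≤ s n := by
  have : Nonempty W := ⟨u⟩
  have hcard : 0 < Nat.card W := Nat.card_pos
  obtain ⟨ε, N, hε, hN⟩ := exists_mul_log_le_of_le_mul_pow (a := 7 * Nat.card W)
    (b := 27 ^ Nat.card W) (by positivity) (one_lt_pow₀ (by norm_num) hcard.ne')
  refine ⟨ε, N, hε, fun c hc s hs n hn ↦ hN n hn (s n) ?_⟩
  exact_mod_cast (h.lt_mul_pow_of_hasLocalCertification hT hc hs n).le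

end Counting

end LocalCert

theorem mainTheorem9 {W : Type*} [Finite W] (T : SimpleGraph W) (hT : T.IsTree) :
    (∀ c : ℕ, 1 ≤ c → ∃ (s : ℕ → ℕ) (C : ℝ),
      LocalCert.HasLocalCertification c 1 (fun _ G => T.Free G) s ∧
        ∀ n : ℕ, 2 ≤ n → (s n : ℝ) ≤ C * Real.log n) ∧
    (4 ≤ T.diam → ∃ (ε : ℝ) (N : ℕ), 0 < ε ∧
      ∀ c : ℕ, 1 ≤ c → ∀ s : ℕ → ℕ,
        LocalCert.HasLocalCertification c 1 (fun _ G => T.Free G) s →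
          ∀ n : ℕ, N ≤ n → ε * Real.log n ≤ (s n : ℝ)) := by
  refine ⟨fun c _ ↦ LocalCert.exists_hasLocalCertification_free_le_mul_log hT c, fun hd ↦ ?_⟩
  obtain ⟨u, p, w, h⟩ := LocalCert.exists_isFarLeaf hT hd
  have : Nontrivial W := ⟨u, w, h.ne⟩
  exact h.exists_mul_log_le_of_hasLocalCertification hT.connected.preconnected.support_eq_univ
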